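/- Consider the system $$\sum_{i=1}^4 x_i^r=\sum_{i=1}^6 y_i^r,\qquad r=1,2,3,4,5.\tag{1}$$ A solution is trivial if two of the $y_i$ are $0$ and the other four are a permutation of $x_1,\dots,x_4$. Two solutions are called equivalent if one is obtained from the other by multiplying all terms by a common nonzero rational number and permuting the $x_i$ and permuting the $y_i$. For all rational $m,n$, the following two families satisfy (1). With $w=m^2+mn+n^2$: (F1) $(x_1,\dots,x_4)=(w,w,-w,-w)$, $(y_1,\dots,y_6)=(m^2-n^2,\,-m^2-2mn,\,2mn+n^2,\,-2mn-n^2,\,m^2+2mn,\,-m^2+n^2)$; (F2) $(x_1,\dots,x_4)=(3w,2w,-w,2w)$, $(y_1,\dots,y_6)=(3m^2+3mn,\,-3mn,\,3mn+3n^2,\,2m^2-mn-n^2,\,2m^2+5mn+2n^2,\,-m^2-mn+2n^2)$. For rational $u,v$ put $$\begin{aligned} x_1&=uv^2+(6u^3-12u^2+32u-32)v+9u^5-36u^4+96u^3-336u^2+240u,\\ x_2&=(2u-2)v^2+(12u^3-48u^2+40u-16)v+18u^5-126u^4+264u^3-288u^2+96,\\ y_1&=(2u-2)v^2+(12u^3-48u^2+48u)v+18u^5-126u^4+288u^3-144u^2+96u-96,\\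 y_2&=uv^2+(6u^3-12u^2-32u+32)v+9u^5-36u^4-96u^3+240u^2-144u,\\ y_3&=2v^2+(24u^2-40u+16)v+54u^4-264u^3+192u^2+96u-96,\\ x_3&=-x_1,\quad x_4=-x_2,\quad y_4=-y_3,\quad y_5=-y_2,\quad y_6=-y_1. \end{aligned}\tag{2}$$ (a) If $u,v\in\mathbb{Q}$ satisfy $$v^2=9u^4-72u^3+24u^2+96u-48,\tag{3}$$ then (2) is a solution of (1). (b) The curve (3) is birational over $\mathbb{Q}$ to the elliptic curve $E: Y^2=X^3-21X-20$, by the mutually inverse maps $$u=\frac{6X+2Y-12}{3X-24},\qquad v=\frac{4X^3-96X^2+84X-144Y+832}{3(X-8)^2},\tag{4}$$ $$X=\frac{9u^2-36u+3v+4}{8},\qquad Y=\frac{27u^3-162u^2+9uv+36u-18v+72}{16},$$ that is, these formulas define mutually inverse $\mathbb{Q}$-isomorphisms of the function fields. On rational points, the second pair of formulas maps affine points of (3) to affine points of $E$, (4) maps affine points of $E$ with $X\ne 8$ to affine points of (3), and the two maps are inverse to each other between the points with $X\neq 8$ on both sides. (c) The point $P=(-3,4)$ has infinite order in $E(\mathbb{Q})$,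 and (3) has infinitely many rational solutions. (d) There are infinitely many pairwise inequivalent nontrivial integer solutions of (1), each of them a nonzero rational multiple of the solution given by (4) and (2) at some multiple $nP$ of $P$ (an affine point with $X\ne 8$), and none of them equivalent to a member of (F1) or (F2) with rational $m,n$. -/

import Mathlib

open Polynomial

namespace EqualPowers

/-- `(x, y)` solves `∑ xᵢ ^ r = ∑ yᵢ ^ r` for `r = 1, …, k`. -/
def IsSolution {R : Type*} [CommRing R] (k : ℕ) {a b : ℕ} (x : Fin a → R) (y : Fin b → R) : Prop :=
  ∀ r ∈ Finset.Icc 1 k, ∑ i, x i ^ r = ∑ j, y j ^ r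

/-- A solution (with `a ≤ b`) is trivial if `b - a` of the `yⱼ` vanish and the remaining ones are a
permutation of the `xᵢ`. -/
def IsTrivial {R : Type*} [CommRing R] {a b : ℕ} (x : Fin a → R) (y : Fin b → R) : Prop :=
  ∃ f : Fin a ↪ Fin b, (∀ i, y (f i) = x i) ∧ ∀ j, j ∉ Set.range f → y j = 0

/-- Two pairs of rational tuples agree up to a common nonzero rational factor and up to permuting
the `x`'s among themselves and the `y`'s among themselves. -/
def Equivalent {a b : ℕ} (x : Fin a → ℚ) (y : Fin b → ℚ) (x' : Fin a → ℚ) (y' : Fin b → ℚ) : Prop :=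
  ∃ c : ℚ, c ≠ 0 ∧ ∃ (σ : Equiv.Perm (Fin a)) (τ : Equiv.Perm (Fin b)),
    (∀ i, x' i = c * x (σ i)) ∧ ∀ j, y' j = c * y (τ j)

/-! ### The two parametric families -/

def family1X (m n : ℚ) : Fin 4 → ℚ :=
  ![m ^ 2 + m * n + n ^ 2, m ^ 2 + m * n + n ^ 2, -m ^ 2 - m * n - n ^ 2, -m ^ 2 - m * n - n ^ 2]

def family1Y (m n : ℚ) : Fin 6 → ℚ :=
  ![m ^ 2 - n ^ 2, -m ^ 2 - 2 * m * n, 2 * m * n + n ^ 2, -2 * m * n - n ^ 2, m ^ 2 + 2 * m * n,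
    -m ^ 2 + n ^ 2]

def family2X (m n : ℚ) : Fin 4 → ℚ :=
  ![3 * m ^ 2 + 3 * m * n + 3 * n ^ 2, 2 * m ^ 2 + 2 * m * n + 2 * n ^ 2, -m ^ 2 - m * n - n ^ 2,
    2 * m ^ 2 + 2 * m * n + 2 * n ^ 2]

def family2Y (m n : ℚ) : Fin 6 → ℚ :=
  ![3 * m ^ 2 + 3 * m * n, -3 * m * n, 3 * m * n + 3 * n ^ 2, 2 * m ^ 2 - m * n - n ^ 2,
    2 * m ^ 2 + 5 * m * n + 2 * n ^ 2, -m ^ 2 - m * n + 2 * n ^ 2]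

/-! ### The parametrization in `u, v` -/

def x₁ (u v : ℚ) : ℚ :=
  u * v ^ 2 + (6 * u ^ 3 - 12 * u ^ 2 + 32 * u - 32) * v
    + 9 * u ^ 5 - 36 * u ^ 4 - 336 * u ^ 2 + 96 * u ^ 3 + 240 * u

def x₂ (u v : ℚ) : ℚ :=
  (2 * u - 2) * v ^ 2 + (12 * u ^ 3 - 48 * u ^ 2 + 40 * u - 16) * v
    + 18 * u ^ 5 - 126 * u ^ 4 - 288 * u ^ 2 + 264 * u ^ 3 + 96

def y₁ (u v : ℚ) : ℚ :=
  (2 * u - 2) * v ^ 2 + (12 * u ^ 3 - 48 * u ^ 2 + 48 * u) * v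
    + 18 * u ^ 5 - 126 * u ^ 4 - 144 * u ^ 2 + 288 * u ^ 3 + 96 * u - 96

def y₂ (u v : ℚ) : ℚ :=
  u * v ^ 2 + (6 * u ^ 3 - 12 * u ^ 2 - 32 * u + 32) * v
    + 9 * u ^ 5 - 36 * u ^ 4 + 240 * u ^ 2 - 96 * u ^ 3 - 144 * u

def y₃ (u v : ℚ) : ℚ :=
  2 * v ^ 2 + (24 * u ^ 2 - 40 * u + 16) * v
    + 54 * u ^ 4 - 264 * u ^ 3 + 96 * u + 192 * u ^ 2 - 96

def paramX (u v : ℚ) : Fin 4 → ℚ := ![x₁ u v, x₂ u v, -x₁ u v, -x₂ u v]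

def paramY (u v : ℚ) : Fin 6 → ℚ := ![y₁ u v, y₂ u v, y₃ u v, -y₃ u v, -y₂ u v, -y₁ u v]

/-! ### The quartic, the cubic and the maps between them -/

/-- `(u, v)` lies on `v² = 9u⁴ - 72u³ + 24u² + 96u - 48`. -/
def OnQuartic (u v : ℚ) : Prop :=
  v ^ 2 = 9 * u ^ 4 - 72 * u ^ 3 + 24 * u ^ 2 + 96 * u - 48

/-- The polynomial `v² - (9u⁴ - 72u³ + 24u² + 96u - 48)` in `ℚ[u][v]`. -/
noncomputable def quarticPolynomial : ℚ[X][X] :=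
  X ^ 2 - C (9 * X ^ 4 - 72 * X ^ 3 + 24 * X ^ 2 + 96 * X - 48)

/-- The affine coordinate ring `ℚ[u, v] / (v² - (9u⁴ - 72u³ + 24u² + 96u - 48))`. -/
abbrev QuarticRing : Type := AdjoinRoot quarticPolynomial

/-- The function field of the quartic curve. -/
abbrev QuarticFunctionField : Type := FractionRing QuarticRing

/-- The coordinate functions `u` and `v` on the quartic. -/
noncomputable def coordU : QuarticFunctionField :=
  algebraMap QuarticRing QuarticFunctionField (AdjoinRoot.of quarticPolynomial X)

noncomputable def coordV : QuarticFunctionField :=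
  algebraMap QuarticRing QuarticFunctionField (AdjoinRoot.root quarticPolynomial)

/-- The Weierstrass curve `Y² = X³ - 21X - 20` over `ℚ`. -/
def E : WeierstrassCurve ℚ := ⟨0, 0, 0, -21, -20⟩

/-- The coordinate functions `X` and `Y` on the cubic. -/
noncomputable def coordX : E.toAffine.FunctionField :=
  algebraMap E.toAffine.CoordinateRing E.toAffine.FunctionField
    (AdjoinRoot.of E.toAffine.polynomial X)

noncomputable def coordY : E.toAffine.FunctionField :=
  algebraMap E.toAffine.CoordinateRing E.toAffine.FunctionField
    (AdjoinRoot.root E.toAffine.polynomial)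

section Maps

variable {K : Type*} [Field K]

def toU (X Y : K) : K := (6 * X + 2 * Y - 12) / (3 * X - 24)

def toV (X Y : K) : K :=
  (4 * X ^ 3 - 96 * X ^ 2 + 84 * X - 144 * Y + 832) / (3 * (X - 8) ^ 2)

def toX (u v : K) : K := (9 * u ^ 2 - 36 * u + 3 * v + 4) / 8

def toY (u v : K) : K :=
  (27 * u ^ 3 - 162 * u ^ 2 + 9 * u * v + 36 * u - 18 * v + 72) / 16

end Maps

/-! ### The point `P = (-3, 4)` and the solutions coming from its multiples -/

theorem nonsingular_P : E.toAffine.Nonsingular (-3) 4 := by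
  rw [WeierstrassCurve.Affine.nonsingular_iff, WeierstrassCurve.Affine.equation_iff]
  norm_num [E]

def P : E.toAffine.Point := .some (-3) 4 nonsingular_P

/-- `(x, y)` is proportional (with nonzero rational factor) to the value of the parametrization at
the point `(u, v)` of the quartic that corresponds to a multiple `n • P`, an affine point with
`X ≠ 8`. -/
def ComesFromMultiple (x : Fin 4 → ℚ) (y : Fin 6 → ℚ) : Prop :=
  ∃ (n : ℕ) (X Y : ℚ) (h : E.toAffine.Nonsingular X Y), n • P = .some X Y h ∧ X ≠ 8 ∧
    ∃ c : ℚ, c ≠ 0 ∧ (∀ i, x i = c * paramX (toU X Y) (toV X Y) i) ∧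
      ∀ j, y j = c * paramY (toU X Y) (toV X Y) j

end EqualPowers

namespace EqualPowers

/-! ### The parametrization and the two families solve the system -/

/-! In (2) both sides are symmetric under negation, so odd powers cancel and only exponents 2 and 4
matter; modulo the quartic these become polynomial identities in `u`. The birational maps are
likewise explicit identities. They are proved over an arbitrary field of characteristic 0, so that
they apply to rational points, to the generic point (which gives the isomorphism of function fields)
and over `ℚ_[2]`.

Everything infinite is 2-adic. Since `2 • P` has abscissa 105/16, and doubling multiplies `‖X‖` by 4
once `‖X‖ > 1`, the points `2 ^ (k + 1) • P` have `‖X‖ = 4 ^ (k + 2)` and are distinct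
(`exists_two_pow_nsmul_P`). These points approach the origin of E in the 2-adic topology, and there
`u` is large and `v` is close to `3 * u ^ 2`. Each term of (2) is then dominated by its leading
term: 36, 72, 72, 36 times `u ^ 5` for x₁, x₂, y₁, y₂, and 144 times `u ^ 4` for y₃ (`norm_param`).

Hence no yⱼ vanishes, so the solution is nontrivial, and the largest ratio `‖yᵢ‖ / ‖yⱼ‖` is `4 *
‖u‖`. Such ratios survive scaling and permutation, so distinct k give inequivalent solutions. (F1)
is excluded because its xᵢ agree up to sign while here `‖x₁‖ ≠ ‖x₂‖`; (F2) because its xᵢ sum to 6w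
while here the sum is 0. -/

theorem add_mul_sq_of_sq_eq {R : Type*} [CommRing R] {A B v q : R} (h : v ^ 2 = q) :
    (A + B * v) ^ 2 = A ^ 2 + B ^ 2 * q + 2 * A * B * v := by
  linear_combination B ^ 2 * h

/-- Reduces a fourth power to the basis 1, `v`; once everything is in this normal form, `ring` can
decide identities on the curve. -/
theorem add_mul_pow_four_of_sq_eq {R : Type*} [CommRing R] {A B v q : R} (h : v ^ 2 = q) :
    (A + B * v) ^ 4 = A ^ 4 + 6 * A ^ 2 * B ^ 2 * q + B ^ 4 * q ^ 2
      + (4 * A ^ 3 * B + 4 * A * B ^ 3 * q) * v := by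
  linear_combination (6 * A ^ 2 * B ^ 2 + 4 * A * B ^ 3 * v + B ^ 4 * (v ^ 2 + q)) * h

theorem isSolution_five_iff {R : Type*} [CommRing R] {a b : ℕ} {x : Fin a → R} {y : Fin b → R} :
    IsSolution 5 x y ↔ ∑ i, x i ^ 1 = ∑ j, y j ^ 1 ∧ ∑ i, x i ^ 2 = ∑ j, y j ^ 2 ∧
      ∑ i, x i ^ 3 = ∑ j, y j ^ 3 ∧ ∑ i, x i ^ 4 = ∑ j, y j ^ 4 ∧ ∑ i, x i ^ 5 = ∑ j, y j ^ 5 := by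
  constructor
  · intro h
    exact ⟨h 1 (by simp), h 2 (by simp), h 3 (by simp), h 4 (by simp), h 5 (by simp)⟩
  · rintro ⟨h1, h2, h3, h4, h5⟩ r hr
    rw [Finset.mem_Icc] at hr
    obtain ⟨hr1, hr5⟩ := hr
    interval_cases r <;> assumption

theorem isSolution_param {u v : ℚ} (h : OnQuartic u v) :
    IsSolution 5 (paramX u v) (paramY u v) := by
  unfold OnQuartic at h
  set q := 9 * u ^ 4 - 72 * u ^ 3 + 24 * u ^ 2 + 96 * u - 48 with hq
  have ex₁ : x₁ u v = (u * q + 9 * u ^ 5 - 36 * u ^ 4 - 336 * u ^ 2 + 96 * u ^ 3 + 240 * u)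
      + (6 * u ^ 3 - 12 * u ^ 2 + 32 * u - 32) * v := by
    unfold x₁; linear_combination u * h
  have ex₂ : x₂ u v =
      ((2 * u - 2) * q + 18 * u ^ 5 - 126 * u ^ 4 - 288 * u ^ 2 + 264 * u ^ 3 + 96)
      + (12 * u ^ 3 - 48 * u ^ 2 + 40 * u - 16) * v := by
    unfold x₂; linear_combination (2 * u - 2) * h
  have ey₁ : y₁ u v =
      ((2 * u - 2) * q + 18 * u ^ 5 - 126 * u ^ 4 - 144 * u ^ 2 + 288 * u ^ 3 + 96 * u - 96)
      + (12 * u ^ 3 - 48 * u ^ 2 + 48 * u) * v := by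
    unfold y₁; linear_combination (2 * u - 2) * h
  have ey₂ : y₂ u v = (u * q + 9 * u ^ 5 - 36 * u ^ 4 + 240 * u ^ 2 - 96 * u ^ 3 - 144 * u)
      + (6 * u ^ 3 - 12 * u ^ 2 - 32 * u + 32) * v := by
    unfold y₂; linear_combination u * h
  have ey₃ : y₃ u v = (2 * q + 54 * u ^ 4 - 264 * u ^ 3 + 96 * u + 192 * u ^ 2 - 96)
      + (24 * u ^ 2 - 40 * u + 16) * v := by
    unfold y₃; linear_combination 2 * h
  have e2 : x₁ u v ^ 2 + x₂ u v ^ 2 = y₁ u v ^ 2 + y₂ u v ^ 2 + y₃ u v ^ 2 := by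
    rw [ex₁, ex₂, ey₁, ey₂, ey₃]
    simp only [add_mul_sq_of_sq_eq h]
    rw [hq]; ring
  have e4 : x₁ u v ^ 4 + x₂ u v ^ 4 = y₁ u v ^ 4 + y₂ u v ^ 4 + y₃ u v ^ 4 := by
    rw [ex₁, ex₂, ey₁, ey₂, ey₃]
    simp only [add_mul_pow_four_of_sq_eq h]
    rw [hq]; ring
  simp only [isSolution_five_iff, Fin.sum_univ_four, Fin.sum_univ_six, paramX, paramY]
  simp only [Matrix.cons_val]
  refine ⟨by ring, by linear_combination 2 * e2, by ring, by linear_combination 2 * e4, by ring⟩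

theorem isSolution_family1 (m n : ℚ) : IsSolution 5 (family1X m n) (family1Y m n) := by
  simp only [isSolution_five_iff, Fin.sum_univ_four, Fin.sum_univ_six, family1X, family1Y]
  simp only [Matrix.cons_val]
  refine ⟨by ring, by ring, by ring, by ring, by ring⟩

theorem isSolution_family2 (m n : ℚ) : IsSolution 5 (family2X m n) (family2Y m n) := by
  simp only [isSolution_five_iff, Fin.sum_univ_four, Fin.sum_univ_six, family2X, family2Y]
  simp only [Matrix.cons_val]
  refine ⟨by ring, by ring, by ring, by ring, by ring⟩

/-! ### The maps between the quartic and the cubic -/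

section Maps

variable {K : Type*} [Field K]

theorem quartic_toU_toV [CharZero K] {X Y : K} (h : Y ^ 2 = X ^ 3 - 21 * X - 20) (hX : X ≠ 8) :
    toV X Y ^ 2 = 9 * toU X Y ^ 4 - 72 * toU X Y ^ 3 + 24 * toU X Y ^ 2 + 96 * toU X Y - 48 := by
  obtain ⟨D, rfl⟩ : ∃ D, X = D + 8 := ⟨X - 8, by ring⟩
  have hD : D ≠ 0 := by simpa using hX
  set a := (6 * D + 36) / (3 * D) with ha
  set b := 2 / (3 * D) with hb
  set c := (4 * (D + 8) ^ 3 - 96 * (D + 8) ^ 2 + 84 * (D + 8) + 832) / (3 * D ^ 2) with hc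
  set d := -144 / (3 * D ^ 2) with hd
  set f := (D + 8) ^ 3 - 21 * (D + 8) - 20 with hf
  have hu : toU (D + 8) Y = a + b * Y := by
    have : 3 * (D + 8) - 24 = 3 * D := by ring
    rw [toU, this, ha, hb]; field_simp; ring
  have hv : toV (D + 8) Y = c + d * Y := by
    have : D + 8 - 8 = D := by ring
    rw [toV, this, hc, hd]; field_simp; ring
  rw [hu, hv]
  -- `toU` and `toV` are affine in `Y`. The cofactor is the quotient on dividing each power of `a +
  -- b * Y` and `c + d * Y` by `Y ^ 2 - f`; the remainders cancel.
  have key : (c + d * Y) ^ 2 - (9 * (a + b * Y) ^ 4 - 72 * (a + b * Y) ^ 3 + 24 * (a + b * Y) ^ 2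
      + 96 * (a + b * Y) - 48) = (d ^ 2 - 9 * (6 * a ^ 2 * b ^ 2 + 4 * a * b ^ 3 * Y
        + b ^ 4 * (Y ^ 2 + f)) + 72 * (3 * a * b ^ 2 + b ^ 3 * Y) - 24 * b ^ 2) * (Y ^ 2 - f) := by
    rw [ha, hb, hc, hd, hf]
    field_simp
    ring
  rw [← sub_eq_zero, key, h, sub_self, mul_zero]

theorem toX_toU_toV [CharZero K] {X Y : K} (h : Y ^ 2 = X ^ 3 - 21 * X - 20) (hX : X ≠ 8) :
    toX (toU X Y) (toV X Y) = X := by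
  obtain ⟨D, rfl⟩ : ∃ D, X = D + 8 := ⟨X - 8, by ring⟩
  have hD : D ≠ 0 := by simpa using hX
  have key : toX (toU (D + 8) Y) (toV (D + 8) Y) - (D + 8) =
      1 / (2 * D ^ 2) * (Y ^ 2 - ((D + 8) ^ 3 - 21 * (D + 8) - 20)) := by
    have h1 : 3 * (D + 8) - 24 = 3 * D := by ring
    have h2 : D + 8 - 8 = D := by ring
    rw [toX, toU, toV, h1, h2]
    field_simp
    ring
  rw [← sub_eq_zero, key, h, sub_self, mul_zero]

theorem toY_toU_toV [CharZero K] {X Y : K} (h : Y ^ 2 = X ^ 3 - 21 * X - 20) (hX : X ≠ 8) :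
    toY (toU X Y) (toV X Y) = Y := by
  obtain ⟨D, rfl⟩ : ∃ D, X = D + 8 := ⟨X - 8, by ring⟩
  have hD : D ≠ 0 := by simpa using hX
  have key : toY (toU (D + 8) Y) (toV (D + 8) Y) - Y =
      (27 * (3 * ((6 * D + 36) / (3 * D)) * (2 / (3 * D)) ^ 2 + (2 / (3 * D)) ^ 3 * Y)
        - 162 * (2 / (3 * D)) ^ 2 + 9 * (2 / (3 * D)) * (-144 / (3 * D ^ 2))) / 16
      * (Y ^ 2 - ((D + 8) ^ 3 - 21 * (D + 8) - 20)) := by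
    have h1 : 3 * (D + 8) - 24 = 3 * D := by ring
    have h2 : D + 8 - 8 = D := by ring
    rw [toY, toU, toV, h1, h2]
    field_simp
    ring
  rw [← sub_eq_zero, key, h, sub_self, mul_zero]

theorem cubic_toX_toY [CharZero K] {u v : K}
    (h : v ^ 2 = 9 * u ^ 4 - 72 * u ^ 3 + 24 * u ^ 2 + 96 * u - 48) :
    toY u v ^ 2 = toX u v ^ 3 - 21 * toX u v - 20 := by
  unfold toX toY
  linear_combination (((9 * u - 18) / 16) ^ 2
    - (3 * ((9 * u ^ 2 - 36 * u + 4) / 8) * (3 / 8) ^ 2 + (3 / 8) ^ 3 * v)) * h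

/-- This holds identically in `u` and `v`; the quartic equation is needed only to recover `v`. -/
theorem toU_toX_toY [CharZero K] {u v : K} (hX : toX u v ≠ 8) :
    toU (toX u v) (toY u v) = u := by
  have hD : 3 * toX u v - 24 ≠ 0 := fun h => hX (by linear_combination h / 3)
  rw [toU, div_eq_iff hD]
  unfold toX toY
  ring

theorem toV_toX_toY [CharZero K] {u v : K}
    (h : v ^ 2 = 9 * u ^ 4 - 72 * u ^ 3 + 24 * u ^ 2 + 96 * u - 48) (hX : toX u v ≠ 8) :
    toV (toX u v) (toY u v) = v := by
  have hD : 3 * (toX u v - 8) ^ 2 ≠ 0 :=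
    mul_ne_zero (by norm_num) (pow_ne_zero _ (sub_ne_zero.mpr hX))
  rw [toV, div_eq_iff hD]
  unfold toX toY
  linear_combination (4 * (3 * ((9 * u ^ 2 - 36 * u + 4) / 8) * (3 / 8) ^ 2 + (3 / 8) ^ 3 * v)
    - 96 * (3 / 8) ^ 2 - 3 * (2 * ((9 * u ^ 2 - 36 * u + 4) / 8 - 8) * (3 / 8) + (3 / 8) ^ 2 * v))
    * h

end Maps

theorem equation_E_iff {X Y : ℚ} : E.toAffine.Equation X Y ↔ Y ^ 2 = X ^ 3 - 21 * X - 20 := by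
  rw [WeierstrassCurve.Affine.equation_iff]
  simp only [E]
  constructor <;> intro h <;> linear_combination h

theorem isElliptic_E : E.IsElliptic := by
  rw [WeierstrassCurve.isElliptic_iff, isUnit_iff_ne_zero]
  norm_num [E, WeierstrassCurve.Δ, WeierstrassCurve.b₂, WeierstrassCurve.b₄, WeierstrassCurve.b₆,
    WeierstrassCurve.b₈]

/-! ### The function fields -/

theorem quarticPolynomial_monic : quarticPolynomial.Monic := by
  unfold quarticPolynomial
  exact monic_X_pow_sub_C _ two_ne_zero

/-- A factorization would make the quartic in `u` a square in ℚ[u], but its value at `u = 0` is -48,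
which is negative. -/
theorem quarticPolynomial_irreducible : Irreducible quarticPolynomial := by
  have hdeg : quarticPolynomial.natDegree = 2 := by
    unfold quarticPolynomial
    exact natDegree_X_pow_sub_C
  by_contra hirr
  obtain ⟨a, b, h0, h1⟩ :=
    (quarticPolynomial_monic.not_irreducible_iff_exists_add_mul_eq_coeff hdeg).mp hirr
  simp only [quarticPolynomial, coeff_sub, coeff_X_pow, coeff_C] at h0 h1
  have h0' := congrArg (eval 0) h0
  have h1' := congrArg (eval 0) h1
  simp at h0' h1'
  have hb : eval 0 b = -eval 0 a := by linear_combination -h1'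
  rw [hb] at h0'
  nlinarith [sq_nonneg (eval 0 a)]

theorem isDomain_quarticRing : IsDomain QuarticRing :=
  AdjoinRoot.isDomain_of_prime quarticPolynomial_irreducible.prime

theorem charZero_functionField : CharZero E.toAffine.FunctionField :=
  algebraRat.charZero _

section FunctionFields

attribute [local instance] isDomain_quarticRing

theorem coordY_sq : coordY ^ 2 = coordX ^ 3 - 21 * coordX - 20 := by
  have h : AdjoinRoot.mk E.toAffine.polynomial E.toAffine.polynomial = 0 := AdjoinRoot.mk_self
  conv at h => enter [1, 2]; rw [WeierstrassCurve.Affine.polynomial]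
  have h' := congrArg (algebraMap E.toAffine.CoordinateRing E.toAffine.FunctionField) h
  have ha : E.toAffine.a₁ = 0 ∧ E.toAffine.a₂ = 0 ∧ E.toAffine.a₃ = 0 ∧ E.toAffine.a₄ = -21 ∧
      E.toAffine.a₆ = -20 := ⟨rfl, rfl, rfl, rfl, rfl⟩
  simp only [ha, map_sub, map_add, map_mul, map_pow, map_ofNat, map_neg, AdjoinRoot.mk_X, map_zero,
    AdjoinRoot.mk_C] at h'
  unfold coordX coordY
  linear_combination h'

theorem aeval_coordX (p : ℚ[X]) : aeval coordX p =
    algebraMap E.toAffine.CoordinateRing E.toAffine.FunctionField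
      (algebraMap ℚ[X] E.toAffine.CoordinateRing p) := by
  have h : coordX = algebraMap E.toAffine.CoordinateRing E.toAffine.FunctionField
      (algebraMap ℚ[X] E.toAffine.CoordinateRing X) := rfl
  rw [h, aeval_algebraMap_apply, aeval_algebraMap_apply, aeval_X_left_apply]

theorem transcendental_coordX : Transcendental ℚ coordX := by
  rw [transcendental_iff]
  intro p hp
  rw [aeval_coordX] at hp
  have h := (map_eq_zero_iff _ (IsFractionRing.injective E.toAffine.CoordinateRing
    E.toAffine.FunctionField)).mp hp
  exact (map_eq_zero_iff _ (FaithfulSMul.algebraMap_injective ℚ[X] _)).mp h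

theorem coordX_ne_eight : coordX ≠ 8 := by
  intro h
  apply transcendental_coordX
  rw [h]
  exact_mod_cast isAlgebraic_natCast 8

theorem quartic_coord : toV coordX coordY ^ 2 = 9 * toU coordX coordY ^ 4 -
    72 * toU coordX coordY ^ 3 + 24 * toU coordX coordY ^ 2 + 96 * toU coordX coordY - 48 :=
  have := charZero_functionField
  quartic_toU_toV coordY_sq coordX_ne_eight

theorem toX_coord : toX (toU coordX coordY) (toV coordX coordY) = coordX :=
  have := charZero_functionField
  toX_toU_toV coordY_sq coordX_ne_eight

theorem toY_coord : toY (toU coordX coordY) (toV coordX coordY) = coordY :=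
  have := charZero_functionField
  toY_toU_toV coordY_sq coordX_ne_eight

/-- If `u` were algebraic, the quartic equation would make `v` algebraic, hence also `coordX`, which
is a polynomial in `u` and `v`. -/
theorem transcendental_toU_coord : Transcendental ℚ (toU coordX coordY) := by
  intro hU
  have hq (n : ℕ) : IsAlgebraic ℚ (n : E.toAffine.FunctionField) := isAlgebraic_natCast n
  have hV : IsAlgebraic ℚ (toV coordX coordY) := by
    refine IsAlgebraic.of_pow two_pos ?_
    rw [quartic_coord]
    exact ((((((hq 9).mul (hU.pow 4)).sub ((hq 72).mul (hU.pow 3))).add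
      ((hq 24).mul (hU.pow 2))).add ((hq 96).mul hU)).sub (hq 48))
  apply transcendental_coordX
  rw [← toX_coord, toX, div_eq_mul_inv]
  exact (((((hq 9).mul (hU.pow 2)).sub ((hq 36).mul hU)).add ((hq 3).mul hV)).add (hq 4)).mul
    (hq 8).inv

theorem eval₂_quarticPolynomial {K : Type*} [Field K] [Algebra ℚ K] (u v : K) :
    quarticPolynomial.eval₂ ((aeval u : ℚ[X] →ₐ[ℚ] K) : ℚ[X] →+* K) v =
      v ^ 2 - (9 * u ^ 4 - 72 * u ^ 3 + 24 * u ^ 2 + 96 * u - 48) := by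
  simp only [quarticPolynomial, eval₂_sub, eval₂_pow, eval₂_X, eval₂_C]
  simp only [RingHom.coe_coe, map_sub, map_add, map_mul, map_pow, map_ofNat, aeval_X]

/-- The pullback of regular functions on the quartic along the rational map from the cubic. -/
noncomputable def quarticPullback : QuarticRing →ₐ[ℚ] E.toAffine.FunctionField :=
  AdjoinRoot.liftAlgHom quarticPolynomial (aeval (toU coordX coordY)) (toV coordX coordY) (by
    exact (eval₂_quarticPolynomial _ _).trans
      (sub_eq_zero.mpr quartic_coord))

theorem quarticPullback_of (p : ℚ[X]) :
    quarticPullback (AdjoinRoot.of quarticPolynomial p) = aeval (toU coordX coordY) p :=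
  AdjoinRoot.liftAlgHom_of ..

theorem quarticPullback_root :
    quarticPullback (AdjoinRoot.root quarticPolynomial) = toV coordX coordY :=
  AdjoinRoot.liftAlgHom_root ..

/-- The quartic ring is integral over ℚ[u], so an ideal of this domain that meets ℚ[u] only in 0 is
itself 0; the kernel is such an ideal because `u` has transcendental image. -/
theorem quarticPullback_injective : Function.Injective quarticPullback := by
  have : Algebra.IsIntegral ℚ[X] QuarticRing :=
    have := quarticPolynomial_monic.finite_adjoinRoot
    inferInstance
  have h : RingHom.ker quarticPullback = ⊥ := by
    apply Ideal.IsIntegral.eq_bot_of_comap_eq_bot (R := ℚ[X])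
    rw [eq_bot_iff]
    intro p hp
    rw [Ideal.mem_comap, RingHom.mem_ker, AdjoinRoot.algebraMap_eq, quarticPullback_of] at hp
    exact transcendental_iff.mp transcendental_toU_coord p hp
  exact (RingHom.injective_iff_ker_eq_bot quarticPullback).mpr h

/-- The homomorphism of function fields induced by the rational map from the cubic to the
quartic. -/
noncomputable def functionFieldHom : QuarticFunctionField →ₐ[ℚ] E.toAffine.FunctionField :=
  IsFractionRing.liftAlgHom quarticPullback_injective

theorem functionFieldHom_algebraMap (z : QuarticRing) :
    functionFieldHom (algebraMap QuarticRing QuarticFunctionField z) = quarticPullback z :=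
  IsFractionRing.lift_algebraMap quarticPullback_injective z

theorem functionFieldHom_coordU : functionFieldHom coordU = toU coordX coordY := by
  rw [coordU, functionFieldHom_algebraMap, quarticPullback_of, aeval_X]

theorem functionFieldHom_coordV : functionFieldHom coordV = toV coordX coordY := by
  rw [coordV, functionFieldHom_algebraMap, quarticPullback_root]

theorem map_toX {K L : Type*} [Field K] [Field L] (f : K →+* L) (u v : K) :
    f (toX u v) = toX (f u) (f v) := by
  simp only [toX, map_div₀, map_sub, map_add, map_mul, map_pow, map_ofNat]

theorem map_toY {K L : Type*} [Field K] [Field L] (f : K →+* L) (u v : K) :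
    f (toY u v) = toY (f u) (f v) := by
  simp only [toY, map_div₀, map_sub, map_add, map_mul, map_pow, map_ofNat]

/-- The image is a subfield containing `coordX` and `coordY`, by the inverse formulas, and these two
generate the function field. -/
theorem functionFieldHom_surjective : Function.Surjective functionFieldHom := by
  have hX : coordX ∈ functionFieldHom.fieldRange := by
    refine ⟨toX coordU coordV, ?_⟩
    rw [← toX_coord, ← functionFieldHom_coordU,
      ← functionFieldHom_coordV]
    exact map_toX functionFieldHom.toRingHom coordU coordV
  have hY : coordY ∈ functionFieldHom.fieldRange := by
    refine ⟨toY coordU coordV, ?_⟩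
    rw [← toY_coord, ← functionFieldHom_coordU,
      ← functionFieldHom_coordV]
    exact map_toY functionFieldHom.toRingHom coordU coordV
  have hp (p : ℚ[X]) : aeval coordX p ∈ functionFieldHom.fieldRange := by
    rw [aeval_eq_sum_range]
    exact sum_mem fun i _ => IntermediateField.smul_mem _ (pow_mem hX i)
  have hring (a : E.toAffine.CoordinateRing) :
      algebraMap _ E.toAffine.FunctionField a ∈ functionFieldHom.fieldRange := by
    obtain ⟨p, q, rfl⟩ := WeierstrassCurve.Affine.CoordinateRing.exists_smul_basis_eq a
    rw [map_add, Algebra.smul_def, Algebra.smul_def, map_mul, map_mul, ← aeval_coordX,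
      ← aeval_coordX, map_one, mul_one]
    exact add_mem (hp p) (mul_mem (hp q) hY)
  intro z
  obtain ⟨a, b, -, rfl⟩ := IsFractionRing.div_surjective (A := E.toAffine.CoordinateRing) z
  exact div_mem (hring a) (hring b)

end FunctionFields

theorem exists_functionField_equiv :
    ∃ φ : QuarticFunctionField ≃ₐ[ℚ] E.toAffine.FunctionField,
      φ coordU = toU coordX coordY ∧ φ coordV = toV coordX coordY ∧
      coordX = toX (φ coordU) (φ coordV) ∧ coordY = toY (φ coordU) (φ coordV) := by
  have := isDomain_quarticRing
  let φ : QuarticFunctionField ≃ₐ[ℚ] E.toAffine.FunctionField := AlgEquiv.ofBijective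
    functionFieldHom ⟨functionFieldHom.toRingHom.injective, functionFieldHom_surjective⟩
  have hU : φ coordU = toU coordX coordY := functionFieldHom_coordU
  have hV : φ coordV = toV coordX coordY := functionFieldHom_coordV
  refine ⟨φ, hU, hV, ?_, ?_⟩
  · rw [hU, hV, toX_coord]
  · rw [hU, hV, toY_coord]

/-! ### Multiples of `P` and their `2`-adic size -/

theorem norm_add_eq_of_norm_lt {a b : ℚ_[2]} (h : ‖b‖ < ‖a‖) : ‖a + b‖ = ‖a‖ := by
  rw [Padic.add_eq_max_of_ne h.ne', max_eq_left h.le]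

/-- The form in which leading terms are isolated: below, `s` is the inverse of a 2-adically large
quantity and `z` collects all lower-order terms. -/
theorem norm_add_mul_integer {c : ℚ_[2]} {s : ℤ_[2]} (h : ‖s‖ < ‖c‖) (z : ℤ_[2]) :
    ‖c + s * z‖ = ‖c‖ := by
  apply norm_add_eq_of_norm_lt
  rw [norm_mul]
  exact (mul_le_of_le_one_right (norm_nonneg _) z.norm_le_one).trans_lt h

theorem norm_padic_two : ‖(2 : ℚ_[2])‖ = 1 / 2 := by
  simpa using Padic.norm_p (p := 2)

theorem padicInt_coe_ofNat (n : ℕ) [n.AtLeastTwo] :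
    ((ofNat(n) : ℤ_[2]) : ℚ_[2]) = ofNat(n) :=
  map_ofNat PadicInt.Coe.ringHom n

theorem norm_padic_odd (n : ℤ) : ‖(2 * n + 1 : ℚ_[2])‖ = 1 := by
  have h : ‖(2 : ℤ_[2])‖ < ‖(1 : ℚ_[2])‖ := by
    rw [PadicInt.norm_def, padicInt_coe_ofNat, norm_padic_two, norm_one]; norm_num
  simpa [add_comm, padicInt_coe_ofNat] using norm_add_mul_integer h n

theorem exists_integer_eq {a : ℚ_[2]} (h : ‖a‖ ≤ 1) : ∃ z : ℤ_[2], (z : ℚ_[2]) = a := ⟨⟨a, h⟩, rfl⟩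

theorem norm_Y_sq {X Y : ℚ_[2]} (h : Y ^ 2 = X ^ 3 - 21 * X - 20) (hX : 1 < ‖X‖) :
    ‖Y‖ ^ 2 = ‖X‖ ^ 3 := by
  have hX0 : X ≠ 0 := norm_pos_iff.mp (one_pos.trans hX)
  obtain ⟨t, ht⟩ := exists_integer_eq (a := X⁻¹) (by rw [norm_inv]; exact inv_le_one_of_one_le₀ hX.le)
  have ht' : ‖t‖ < ‖(1 : ℚ_[2])‖ := by
    rw [PadicInt.norm_def, ht, norm_inv, norm_one]; exact inv_lt_one_of_one_lt₀ hX
  have hY : Y ^ 2 = X ^ 3 * (1 + t * ((-21 * t - 20 * t ^ 2 : ℤ_[2]) : ℚ_[2])) := by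
    push_cast [padicInt_coe_ofNat]
    rw [ht, h]
    field_simp
    ring
  rw [← norm_pow, hY, norm_mul, norm_add_mul_integer ht', norm_one, mul_one, norm_pow]

/-- `h'` is the duplication formula. Its numerator is dominated by `X ^ 4`, while `4 * Y ^ 2` has
norm `‖X‖ ^ 3 / 4`. -/
theorem norm_X_double {X Y X' : ℚ_[2]} (h : Y ^ 2 = X ^ 3 - 21 * X - 20) (hX : 1 < ‖X‖)
    (h' : X' * (4 * Y ^ 2) = X ^ 4 + 42 * X ^ 2 + 160 * X + 441) : ‖X'‖ = 4 * ‖X‖ := by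
  have hX0 : X ≠ 0 := norm_pos_iff.mp (one_pos.trans hX)
  obtain ⟨t, ht⟩ := exists_integer_eq (a := X⁻¹) (by rw [norm_inv]; exact inv_le_one_of_one_le₀ hX.le)
  have ht' : ‖t‖ < ‖(1 : ℚ_[2])‖ := by
    rw [PadicInt.norm_def, ht, norm_inv, norm_one]; exact inv_lt_one_of_one_lt₀ hX
  have hN : X ^ 4 + 42 * X ^ 2 + 160 * X + 441 =
      X ^ 4 * (1 + t * ((42 * t + 160 * t ^ 2 + 441 * t ^ 3 : ℤ_[2]) : ℚ_[2])) := by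
    push_cast [padicInt_coe_ofNat]
    rw [ht]
    field_simp
    ring
  have h4 : ‖(4 : ℚ_[2])‖ = 1 / 4 := by
    rw [show (4 : ℚ_[2]) = 2 ^ 2 by norm_num, norm_pow, norm_padic_two]; norm_num
  have hn := congrArg norm h'
  rw [hN, norm_mul, norm_mul, norm_mul, norm_add_mul_integer ht', norm_one, mul_one, norm_pow,
    norm_pow, norm_Y_sq h hX, h4] at hn
  have : ‖X‖ ^ 3 ≠ 0 := pow_ne_zero _ (one_pos.trans hX).ne'
  apply mul_right_cancel₀ this
  linear_combination 4 * hn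

theorem two_nsmul_some {x y : ℚ} (h : E.toAffine.Nonsingular x y) (hy : y ≠ 0) :
    ∃ (x' y' : ℚ) (h' : E.toAffine.Nonsingular x' y'),
      2 • (WeierstrassCurve.Affine.Point.some x y h : E.toAffine.Point) = .some x' y' h' ∧
      x' * (4 * y ^ 2) = x ^ 4 + 42 * x ^ 2 + 160 * x + 441 := by
  have hne : y ≠ E.toAffine.negY x y := by
    simp only [WeierstrassCurve.Affine.negY, E]
    intro h
    apply hy
    linarith
  rw [two_nsmul, WeierstrassCurve.Affine.Point.add_self_of_Y_ne hne]
  refine ⟨_, _, _, rfl, ?_⟩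
  have he := equation_E_iff.mp h.1
  rw [WeierstrassCurve.Affine.slope_of_Y_ne rfl hne]
  have key : E.toAffine.addX x x ((3 * x ^ 2 + 2 * E.toAffine.a₂ * x + E.toAffine.a₄
      - E.toAffine.a₁ * y) / (y - E.toAffine.negY x y)) = ((3 * x ^ 2 - 21) / (2 * y)) ^ 2 - 2 * x := by
    simp only [WeierstrassCurve.Affine.addX, WeierstrassCurve.Affine.negY, E]
    ring_nf
  rw [key]
  field_simp
  linear_combination -32 * x * he

theorem exists_two_pow_nsmul_P (k : ℕ) :
    ∃ (X Y : ℚ) (h : E.toAffine.Nonsingular X Y), 2 ^ (k + 1) • P = .some X Y h ∧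
      ‖(X : ℚ_[2])‖ = 4 ^ (k + 2) := by
  induction k with
  | zero =>
    obtain ⟨X, Y, h, hP, hX⟩ := two_nsmul_some nonsingular_P (by norm_num)
    refine ⟨X, Y, h, by simpa [P] using hP, ?_⟩
    -- The duplication formula at (-3, 4) reads 64 X = 420, so X = 105/16.
    have hX' : (X : ℚ_[2]) * 2 ^ 4 = 2 * (52 : ℤ) + 1 := by
      have : X * 2 ^ 4 = 2 * 52 + 1 := by linarith
      exact_mod_cast this
    have hn := congrArg norm hX'
    rw [norm_padic_odd, norm_mul, norm_pow, norm_padic_two] at hn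
    norm_num at hn ⊢
    linarith
  | succ k ih =>
    obtain ⟨X, Y, h, hP, hX⟩ := ih
    have he : (Y : ℚ_[2]) ^ 2 = X ^ 3 - 21 * X - 20 := by
      exact_mod_cast congrArg (Rat.cast : ℚ → ℚ_[2]) (equation_E_iff.mp h.1)
    have hX1 : 1 < ‖(X : ℚ_[2])‖ := by
      rw [hX]; exact one_lt_pow₀ (by norm_num) (by omega)
    have hY : Y ≠ 0 := by
      rintro rfl
      have := norm_Y_sq he hX1
      rw [Rat.cast_zero, norm_zero] at this
      have := pow_pos (one_pos.trans hX1) 3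
      linarith
    obtain ⟨X', Y', h', hP', hX'⟩ := two_nsmul_some h hY
    refine ⟨X', Y', h', by rw [pow_succ 2 (k + 1), mul_comm, mul_nsmul', hP, hP'], ?_⟩
    rw [norm_X_double he hX1 (X' := X')
      (by exact_mod_cast congrArg (Rat.cast : ℚ → ℚ_[2]) hX'), hX]
    ring

theorem not_isOfFinAddOrder_P : ¬ IsOfFinAddOrder P := by
  intro hfin
  have hinf : ((AddSubmonoid.multiples P : AddSubmonoid E.toAffine.Point) :
      Set E.toAffine.Point).Infinite := by
    refine Set.infinite_of_injective_forall_mem (f := fun k : ℕ => 2 ^ (k + 1) • P) ?_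
      fun k => ⟨2 ^ (k + 1), rfl⟩
    intro k l hkl
    obtain ⟨X, Y, h, hP, hX⟩ := exists_two_pow_nsmul_P k
    obtain ⟨X', Y', h', hP', hX'⟩ := exists_two_pow_nsmul_P l
    simp only [hP, hP', WeierstrassCurve.Affine.Point.some.injEq] at hkl
    rw [hkl.1, hX'] at hX
    have := pow_right_injective₀ (by norm_num : (0 : ℝ) < 4) (by norm_num) hX
    omega
  exact hinf hfin.finite_multiples

theorem infinite_quartic : {p : ℚ × ℚ | OnQuartic p.1 p.2}.Infinite := by
  choose X Y h hP hX using exists_two_pow_nsmul_P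
  have h8 (k : ℕ) : X k ≠ 8 := by
    intro hk
    have := hX k
    rw [hk] at this
    have h1 : ‖((8 : ℚ) : ℚ_[2])‖ ≤ 1 := by
      exact_mod_cast Padic.norm_int_le_one (p := 2) 8
    have h2 : (1 : ℝ) < 4 ^ (k + 2) := one_lt_pow₀ (by norm_num) (by omega)
    linarith
  have he (k : ℕ) := equation_E_iff.mp (h k).1
  refine Set.infinite_of_injective_forall_mem
    (f := fun k : ℕ => (toU (X k) (Y k), toV (X k) (Y k))) ?_
    fun k => quartic_toU_toV (he k) (h8 k)
  intro k l hkl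
  simp only [Prod.mk.injEq] at hkl
  have hXkl : X k = X l := by
    rw [← toX_toU_toV (he k) (h8 k), ← toX_toU_toV (he l) (h8 l), hkl.1, hkl.2]
  have := hX k
  rw [hXkl, hX l] at this
  have := pow_right_injective₀ (by norm_num : (0 : ℝ) < 4) (by norm_num) this
  omega

/-! ### The `2`-adic size of the parametrized solutions -/

theorem norm_toU {X Y : ℚ_[2]} {m : ℕ} (h : Y ^ 2 = X ^ 3 - 21 * X - 20) (hm : 2 ≤ m)
    (hX : ‖X‖ = 4 ^ m) : ‖toU X Y‖ = 2 ^ m / 2 := by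
  have h2m : (4 : ℝ) ≤ 2 ^ m := by
    calc (4 : ℝ) = 2 ^ 2 := by norm_num
      _ ≤ 2 ^ m := pow_le_pow_right₀ one_le_two hm
  have h4 : (4 : ℝ) ^ m = 2 ^ m * 2 ^ m := by rw [← mul_pow]; norm_num
  have hX1 : 16 ≤ ‖X‖ := by rw [hX, h4]; nlinarith
  have hY : ‖Y‖ = 2 ^ m * (2 ^ m * 2 ^ m) := by
    have := norm_Y_sq h (by linarith)
    rw [hX, h4] at this
    refine (pow_left_inj₀ (norm_nonneg _) (by positivity) two_ne_zero).mp ?_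
    rw [this]; ring
  have h8 : ‖X + -8‖ = ‖X‖ := by
    apply norm_add_eq_of_norm_lt
    rw [norm_neg]
    have : ‖((8 : ℤ) : ℚ_[2])‖ ≤ 1 := Padic.norm_int_le_one 8
    push_cast at this
    linarith
  have h3 : ‖(3 : ℚ_[2])‖ = 1 := by
    have := norm_padic_odd 1
    norm_num at this ⊢
    exact this
  have hnum : ‖2 * Y + (6 * X + -12)‖ = ‖2 * Y‖ := by
    apply norm_add_eq_of_norm_lt
    have h6 : ‖((6 : ℤ) : ℚ_[2])‖ ≤ 1 := Padic.norm_int_le_one 6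
    have h12 : ‖((-12 : ℤ) : ℚ_[2])‖ ≤ 1 := Padic.norm_int_le_one (-12)
    push_cast at h6 h12
    refine (Padic.nonarchimedean _ _).trans_lt (max_lt ?_ ?_)
    · rw [norm_mul, norm_mul, norm_padic_two, hX, hY, h4]
      have : (0 : ℝ) < 2 ^ m * 2 ^ m := by positivity
      nlinarith
    · refine h12.trans_lt ?_
      rw [norm_mul, norm_padic_two, hY]
      nlinarith
  have h324 : 3 * X - 24 = 3 * (X + -8) := by ring
  have h612 : 6 * X + 2 * Y - 12 = 2 * Y + (6 * X + -12) := by ring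
  rw [toU, h612, h324, norm_div, hnum, norm_mul, norm_mul, h8, h3, norm_padic_two, hX, hY, h4]
  field_simp

/-- From `toX`, `3 * (V + 3 * U ^ 2) = 8 * X + 36 * U - 4`, where `8 * X` dominates. The value
obtained is exactly `‖6 * U ^ 2‖`, which singles out the branch of the quartic with `V` near `3 * U
^ 2`; on the other branch the leading terms of (2) would cancel. -/
theorem norm_toV_add {X Y : ℚ_[2]} {m : ℕ} (h : Y ^ 2 = X ^ 3 - 21 * X - 20) (hm : 2 ≤ m)
    (hX : ‖X‖ = 4 ^ m) : ‖toV X Y + 3 * toU X Y ^ 2‖ = ‖toU X Y‖ ^ 2 / 2 := by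
  have h2m : (4 : ℝ) ≤ 2 ^ m := by
    calc (4 : ℝ) = 2 ^ 2 := by norm_num
      _ ≤ 2 ^ m := pow_le_pow_right₀ one_le_two hm
  have h4 : (4 : ℝ) ^ m = 2 ^ m * 2 ^ m := by rw [← mul_pow]; norm_num
  have hX8 : X ≠ 8 := by
    rintro rfl
    have : ‖((8 : ℤ) : ℚ_[2])‖ ≤ 1 := Padic.norm_int_le_one 8
    push_cast at this
    rw [hX, h4] at this
    nlinarith
  have hU := norm_toU h hm hX
  have key := toX_toU_toV h hX8
  set U := toU X Y
  set V := toV X Y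
  have h3 : ‖(3 : ℚ_[2])‖ = 1 := by
    have := norm_padic_odd 1
    norm_num at this ⊢
    exact this
  have h9 : ‖(9 : ℚ_[2])‖ = 1 := by
    have := norm_padic_odd 4
    norm_num at this ⊢
    exact this
  have h2 := norm_padic_two
  have e8 : ‖2 ^ 3 * X‖ = ‖U‖ ^ 2 / 2 := by
    rw [norm_mul, norm_pow, h2, hU, hX, h4]; ring
  have e : 3 * (V + 3 * U ^ 2) = 2 ^ 3 * X + (2 ^ 2 * (9 * U) + -(2 ^ 2)) := by
    rw [toX, div_eq_iff (by norm_num)] at key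
    linear_combination key
  have hn : ‖3 * (V + 3 * U ^ 2)‖ = ‖2 ^ 3 * X‖ := by
    rw [e]
    apply norm_add_eq_of_norm_lt
    refine (Padic.nonarchimedean _ _).trans_lt (max_lt ?_ ?_)
    · rw [e8, norm_mul, norm_mul, norm_pow, h2, h9, hU]
      nlinarith
    · rw [e8, norm_neg, norm_pow, h2, hU]
      nlinarith
  rw [norm_mul, h3, one_mul] at hn
  rw [hn, e8]

theorem exists_expansion {U V : ℚ_[2]}
    (h : V ^ 2 = 9 * U ^ 4 - 72 * U ^ 3 + 24 * U ^ 2 + 96 * U - 48) (hU : 1 ≤ ‖U‖)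
    (hV : ‖V + 3 * U ^ 2‖ = ‖U‖ ^ 2 / 2) :
    ∃ s e : ℤ_[2], (s : ℚ_[2]) = U⁻¹ ∧ V = U ^ 2 * (3 + s * e) := by
  have hU0 : U ≠ 0 := norm_pos_iff.mp (one_pos.trans_le hU)
  obtain ⟨s, hs⟩ := exists_integer_eq (a := U⁻¹) (by rw [norm_inv]; exact inv_le_one_of_one_le₀ hU)
  -- The quartic has leading term `9 * U ^ 4`, so this product is only cubic in `U`. The known size
  -- of the second factor then bounds the first by a multiple of `‖U‖`.
  have key : (V - 3 * U ^ 2) * (V + 3 * U ^ 2) =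
      U ^ 3 * (2 ^ 3 * ((-9 + 3 * s + 12 * s ^ 2 - 6 * s ^ 3 : ℤ_[2]) : ℚ_[2])) := by
    push_cast [padicInt_coe_ofNat]
    rw [hs]
    field_simp
    linear_combination h
  have hn := congrArg norm key
  rw [norm_mul, norm_mul, norm_mul, hV, norm_pow, norm_pow, norm_padic_two] at hn
  have hz := (-9 + 3 * s + 12 * s ^ 2 - 6 * s ^ 3 : ℤ_[2]).norm_le_one
  rw [PadicInt.norm_def] at hz
  have hle : ‖V - 3 * U ^ 2‖ ≤ ‖U‖ := by
    have hp : 0 < ‖U‖ ^ 2 := by positivity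
    have hp3 : 0 ≤ ‖U‖ ^ 3 := by positivity
    have : ‖V - 3 * U ^ 2‖ * (‖U‖ ^ 2 / 2) ≤ ‖U‖ * (‖U‖ ^ 2 / 2) := by
      rw [hn]
      nlinarith [mul_le_of_le_one_right hp3 hz]
    exact le_of_mul_le_mul_right this (by positivity)
  obtain ⟨e, he⟩ := exists_integer_eq (a := (V - 3 * U ^ 2) / U) (by
    rw [norm_div]; exact (div_le_one (by positivity)).mpr hle)
  refine ⟨s, e, hs, ?_⟩
  rw [he, hs]
  field_simp
  ring

/-- The `2`-adic absolute values of the terms of a parametrized solution. -/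
theorem norm_param {u v : ℚ} (h : OnQuartic u v) (hU : 32 ≤ ‖(u : ℚ_[2])‖)
    (hV : ‖(v : ℚ_[2]) + 3 * u ^ 2‖ = ‖(u : ℚ_[2])‖ ^ 2 / 2) :
    ‖(x₁ u v : ℚ_[2])‖ = ‖(u : ℚ_[2])‖ ^ 5 / 4 ∧ ‖(x₂ u v : ℚ_[2])‖ = ‖(u : ℚ_[2])‖ ^ 5 / 8 ∧
    ‖(y₁ u v : ℚ_[2])‖ = ‖(u : ℚ_[2])‖ ^ 5 / 8 ∧ ‖(y₂ u v : ℚ_[2])‖ = ‖(u : ℚ_[2])‖ ^ 5 / 4 ∧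
    ‖(y₃ u v : ℚ_[2])‖ = ‖(u : ℚ_[2])‖ ^ 4 / 16 := by
  have h' : (v : ℚ_[2]) ^ 2 = 9 * u ^ 4 - 72 * u ^ 3 + 24 * u ^ 2 + 96 * u - 48 := by
    exact_mod_cast congrArg (Rat.cast : ℚ → ℚ_[2]) h
  obtain ⟨s, e, hs, hv⟩ := exists_expansion h' (by linarith) hV
  have hu0 : (u : ℚ_[2]) ≠ 0 := norm_pos_iff.mp (by linarith)
  have hs32 : ‖s‖ ≤ 1 / 32 := by
    rw [PadicInt.norm_def, hs, norm_inv, inv_le_comm₀ (by linarith) (by norm_num)]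
    linarith
  have h9 : ‖(9 : ℚ_[2])‖ = 1 := by
    have := norm_padic_odd 4
    norm_num at this ⊢
    exact this
  have h36 : ‖(36 : ℚ_[2])‖ = 1 / 4 := by
    rw [show (36 : ℚ_[2]) = 2 ^ 2 * 9 by norm_num, norm_mul, norm_pow, norm_padic_two, h9]
    norm_num
  have h72 : ‖(72 : ℚ_[2])‖ = 1 / 8 := by
    rw [show (72 : ℚ_[2]) = 2 ^ 3 * 9 by norm_num, norm_mul, norm_pow, norm_padic_two, h9]
    norm_num
  have h144 : ‖(144 : ℚ_[2])‖ = 1 / 16 := by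
    rw [show (144 : ℚ_[2]) = 2 ^ 4 * 9 by norm_num, norm_mul, norm_pow, norm_padic_two, h9]
    norm_num
  -- The bound 32 in `hU` serves here: `‖s‖` must lie below 1/16, the norm of the most 2-divisible
  -- leading coefficient, 144.
  have l36 : ‖s‖ < ‖(36 : ℚ_[2])‖ := by rw [h36]; linarith
  have l72 : ‖s‖ < ‖(72 : ℚ_[2])‖ := by rw [h72]; linarith
  have l144 : ‖s‖ < ‖(144 : ℚ_[2])‖ := by rw [h144]; linarith
  have hsu : (s : ℚ_[2]) * u = 1 := by rw [hs, inv_mul_cancel₀ hu0]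
  obtain ⟨w, hw⟩ : ∃ w : ℤ_[2], w = 3 + s * e := ⟨_, rfl⟩
  have ex₁ : (x₁ u v : ℚ_[2]) = u ^ 5 * (36 + s * ((e * (w + 3) + 6 * e
      + (-12 + 32 * s - 32 * s ^ 2) * w - 36 + 96 * s - 336 * s ^ 2 + 240 * s ^ 3 : ℤ_[2]) :
        ℚ_[2])) := by
    unfold x₁
    push_cast [padicInt_coe_ofNat, hw]
    rw [hv, hs]
    field_simp
    ring
  have ex₂ : (x₂ u v : ℚ_[2]) = u ^ 5 * (72 + s * ((2 * e * (w + 3) - 2 * w ^ 2 + 12 * e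
      + (-48 + 40 * s - 16 * s ^ 2) * w - 126 + 264 * s - 288 * s ^ 2 + 96 * s ^ 4 : ℤ_[2]) :
        ℚ_[2])) := by
    unfold x₂
    push_cast [padicInt_coe_ofNat, hw]
    rw [hv, hs]
    field_simp
    ring
  have ey₁ : (y₁ u v : ℚ_[2]) = u ^ 5 * (72 + s * ((2 * e * (w + 3) - 2 * w ^ 2 + 12 * e
      + (-48 + 48 * s) * w - 126 + 288 * s - 144 * s ^ 2 + 96 * s ^ 3 - 96 * s ^ 4 : ℤ_[2]) :
        ℚ_[2])) := by
    unfold y₁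
    push_cast [padicInt_coe_ofNat, hw]
    rw [hv, hs]
    field_simp
    ring
  have ey₂ : (y₂ u v : ℚ_[2]) = u ^ 5 * (36 + s * ((e * (w + 3) + 6 * e
      + (-12 - 32 * s + 32 * s ^ 2) * w - 36 - 96 * s + 240 * s ^ 2 - 144 * s ^ 3 : ℤ_[2]) :
        ℚ_[2])) := by
    unfold y₂
    push_cast [padicInt_coe_ofNat, hw]
    rw [hv, hs]
    field_simp
    ring
  have ey₃ : (y₃ u v : ℚ_[2]) = u ^ 4 * (144 + s * ((2 * e * (w + 3) + 24 * e
      + (-40 + 16 * s) * w - 264 + 192 * s + 96 * s ^ 2 - 96 * s ^ 3 : ℤ_[2]) : ℚ_[2])) := by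
    unfold y₃
    push_cast [padicInt_coe_ofNat, hw]
    rw [hv, hs]
    field_simp
    ring
  refine ⟨?_, ?_, ?_, ?_, ?_⟩
  · rw [ex₁, norm_mul, norm_add_mul_integer l36, h36, norm_pow]; ring
  · rw [ex₂, norm_mul, norm_add_mul_integer l72, h72, norm_pow]; ring
  · rw [ey₁, norm_mul, norm_add_mul_integer l72, h72, norm_pow]; ring
  · rw [ey₂, norm_mul, norm_add_mul_integer l36, h36, norm_pow]; ring
  · rw [ey₃, norm_mul, norm_add_mul_integer l144, h144, norm_pow]; ring

/-! ### Invariants of equivalence classes -/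

/-- The ratios of the `2`-adic absolute values of the entries of a tuple. -/
def ratioSet {b : ℕ} (y : Fin b → ℚ) : Set ℝ :=
  {r | ∃ i j, r = ‖(y i : ℚ_[2])‖ / ‖(y j : ℚ_[2])‖}

theorem Equivalent.ratioSet_eq {a b : ℕ} {x x' : Fin a → ℚ} {y y' : Fin b → ℚ}
    (h : Equivalent x y x' y') : ratioSet y' = ratioSet y := by
  obtain ⟨c, hc, -, τ, -, hy⟩ := h
  have hc' : ‖(c : ℚ_[2])‖ ≠ 0 := norm_ne_zero_iff.mpr (by exact_mod_cast hc)
  have key (i j : Fin b) : ‖(y' i : ℚ_[2])‖ / ‖(y' j : ℚ_[2])‖ =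
      ‖(y (τ i) : ℚ_[2])‖ / ‖(y (τ j) : ℚ_[2])‖ := by
    rw [hy, hy, Rat.cast_mul, Rat.cast_mul, norm_mul, norm_mul, mul_div_mul_left _ _ hc']
  ext r
  constructor
  · rintro ⟨i, j, rfl⟩
    exact ⟨τ i, τ j, key i j⟩
  · rintro ⟨i, j, rfl⟩
    exact ⟨τ.symm i, τ.symm j, by rw [key, τ.apply_symm_apply, τ.apply_symm_apply]⟩

theorem isGreatest_ratioSet_paramY {u v : ℚ} (h : OnQuartic u v) (hU : 32 ≤ ‖(u : ℚ_[2])‖)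
    (hV : ‖(v : ℚ_[2]) + 3 * u ^ 2‖ = ‖(u : ℚ_[2])‖ ^ 2 / 2) :
    IsGreatest (ratioSet (paramY u v)) (4 * ‖(u : ℚ_[2])‖) := by
  obtain ⟨-, -, h1, h2, h3⟩ := norm_param h hU hV
  set N := ‖(u : ℚ_[2])‖
  have hN : 0 < N := by linarith
  have h4 : 0 < N ^ 4 := by positivity
  constructor
  -- The extreme ratio is y₂ over y₃, which sit at indices 1 and 2.
  · refine ⟨1, 2, ?_⟩
    simp only [paramY, Matrix.cons_val]
    rw [h2, h3]
    field_simp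
    norm_num
  · rintro r ⟨i, j, rfl⟩
    have hle (i : Fin 6) : ‖(paramY u v i : ℚ_[2])‖ ≤ N ^ 5 / 4 ∧
        N ^ 4 / 16 ≤ ‖(paramY u v i : ℚ_[2])‖ := by
      fin_cases i <;> simp only [paramY, Fin.reduceFinMk, Matrix.cons_val, Fin.zero_eta, Fin.mk_one,
        Rat.cast_neg, norm_neg, h1, h2, h3] <;> constructor <;> nlinarith
    calc _ ≤ (N ^ 5 / 4) / (N ^ 4 / 16) :=
          div_le_div₀ (by positivity) (hle i).1 (by positivity) (hle j).2
      _ = 4 * N := by field_simp; norm_num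

theorem paramY_ne_zero {u v : ℚ} (h : OnQuartic u v) (hU : 32 ≤ ‖(u : ℚ_[2])‖)
    (hV : ‖(v : ℚ_[2]) + 3 * u ^ 2‖ = ‖(u : ℚ_[2])‖ ^ 2 / 2) (j : Fin 6) : paramY u v j ≠ 0 := by
  obtain ⟨-, -, h1, h2, h3⟩ := norm_param h hU hV
  have hN : 0 < ‖(u : ℚ_[2])‖ := by linarith
  have hne {q : ℚ} (hq : 0 < ‖(q : ℚ_[2])‖) : q ≠ 0 := by
    rintro rfl
    simp at hq
  have e1 : y₁ u v ≠ 0 := hne (by rw [h1]; positivity)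
  have e2 : y₂ u v ≠ 0 := hne (by rw [h2]; positivity)
  have e3 : y₃ u v ≠ 0 := hne (by rw [h3]; positivity)
  fin_cases j <;> simpa [paramY]

theorem not_isTrivial_of_ne_zero {R : Type*} [CommRing R] {a b : ℕ} {x : Fin a → R}
    {y : Fin b → R} (hab : a < b) (hy : ∀ j, y j ≠ 0) : ¬ IsTrivial x y := by
  rintro ⟨f, -, hf⟩
  have hsurj : Function.Surjective f := fun j => by
    by_contra hj
    exact hy j (hf j hj)
  have := Fintype.card_le_of_surjective f hsurj
  simp at this
  omega

theorem not_equivalent_family1 {m n c u v : ℚ} {x : Fin 4 → ℚ} {y : Fin 6 → ℚ} (hc : c ≠ 0)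
    (hx : ∀ i, x i = c * paramX u v i) (hxx : x₁ u v ^ 2 ≠ x₂ u v ^ 2) :
    ¬ Equivalent (family1X m n) (family1Y m n) x y := by
  rintro ⟨d, -, σ, -, hσ, -⟩
  have hF (i : Fin 4) : family1X m n i ^ 2 = (m ^ 2 + m * n + n ^ 2) ^ 2 := by
    fin_cases i <;> simp [family1X] <;> ring
  have hx2 (i : Fin 4) : x i ^ 2 = d ^ 2 * (m ^ 2 + m * n + n ^ 2) ^ 2 := by
    rw [hσ, mul_pow, hF]
  have h0 := hx2 0
  rw [← hx2 1, hx, hx, mul_pow, mul_pow] at h0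
  exact hxx (mul_left_cancel₀ (pow_ne_zero 2 hc) h0)

theorem not_equivalent_family2 {m n c u v : ℚ} {x : Fin 4 → ℚ} {y : Fin 6 → ℚ} (hc : c ≠ 0)
    (hx : ∀ i, x i = c * paramX u v i) (hx₁ : x₁ u v ≠ 0) :
    ¬ Equivalent (family2X m n) (family2Y m n) x y := by
  rintro ⟨d, hd, σ, -, hσ, -⟩
  have hs : ∑ i, x i = 0 := by
    simp only [hx, Fin.sum_univ_four, paramX, Matrix.cons_val]
    ring
  have hs' : ∑ i, x i = d * (6 * (m ^ 2 + m * n + n ^ 2)) := by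
    simp only [hσ]
    rw [Equiv.sum_comp σ fun i => d * family2X m n i]
    simp only [Fin.sum_univ_four, family2X, Matrix.cons_val]
    ring
  -- Comparing the two sums forces w = 0; every xᵢ of the family is a multiple of w, contradicting
  -- `hx₁`.
  have hw : m ^ 2 + m * n + n ^ 2 = 0 := by
    rw [hs'] at hs
    simpa [hd] using hs
  have hF (i : Fin 4) : family2X m n i = 0 := by
    fin_cases i <;> simp only [family2X, Fin.reduceFinMk, Matrix.cons_val, Fin.zero_eta, Fin.mk_one]
    · linear_combination 3 * hw
    · linear_combination 2 * hw
    · linear_combination -hw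
    · linear_combination 2 * hw
  have h0 := hx 0
  rw [hσ, hF, mul_zero] at h0
  exact mul_ne_zero hc hx₁ h0.symm

theorem exists_integer_multiple {a b : ℕ} (x : Fin a → ℚ) (y : Fin b → ℚ) :
    ∃ (c : ℚ) (x' : Fin a → ℤ) (y' : Fin b → ℤ), c ≠ 0 ∧ (∀ i, (x' i : ℚ) = c * x i) ∧
      ∀ j, (y' j : ℚ) = c * y j := by
  obtain ⟨c, hc⟩ := IsLocalization.exist_integer_multiples_of_finite (nonZeroDivisors ℤ)
    (Sum.elim x y)
  choose f hf using hc
  refine ⟨(c : ℤ), fun i => f (.inl i), fun j => f (.inr j), ?_, fun i => ?_, fun j => ?_⟩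
  · exact_mod_cast nonZeroDivisors.coe_ne_zero c
  · simpa using hf (.inl i)
  · simpa using hf (.inr j)

theorem IsSolution.of_smul {k a b : ℕ} {x : Fin a → ℚ} {y : Fin b → ℚ} (h : IsSolution k x y)
    {c : ℚ} {x' : Fin a → ℤ} {y' : Fin b → ℤ} (hx : ∀ i, (x' i : ℚ) = c * x i)
    (hy : ∀ j, (y' j : ℚ) = c * y j) : IsSolution k x' y' := by
  intro r hr
  have : (∑ i, (x' i : ℚ) ^ r) = ∑ j, (y' j : ℚ) ^ r := by
    simp only [hx, hy, mul_pow, ← Finset.mul_sum, h r hr]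
  exact_mod_cast this

/-! ### Infinitely many new solutions -/

theorem exists_solution (k : ℕ) : ∃ s : (Fin 4 → ℤ) × (Fin 6 → ℤ),
    (IsSolution 5 s.1 s.2 ∧ ¬ IsTrivial s.1 s.2 ∧
      ComesFromMultiple (fun i => (s.1 i : ℚ)) (fun j => (s.2 j : ℚ)) ∧
      ∀ m n : ℚ,
        ¬ Equivalent (family1X m n) (family1Y m n)
          (fun i => (s.1 i : ℚ)) (fun j => (s.2 j : ℚ)) ∧
        ¬ Equivalent (family2X m n) (family2Y m n)
          (fun i => (s.1 i : ℚ)) (fun j => (s.2 j : ℚ))) ∧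
    IsGreatest (ratioSet fun j => (s.2 j : ℚ)) (2 ^ (k + 7)) := by
  -- The shift by 4 gives `‖X‖ = 4 ^ (k + 6)`, hence `‖u‖ = 2 ^ (k + 5)`, which is at least 32 as
  -- `norm_param` requires.
  obtain ⟨X, Y, hXY, hP, hX⟩ := exists_two_pow_nsmul_P (k + 4)
  have he := equation_E_iff.mp hXY.1
  have he' : (Y : ℚ_[2]) ^ 2 = X ^ 3 - 21 * X - 20 := by
    exact_mod_cast congrArg (Rat.cast : ℚ → ℚ_[2]) he
  have h8 : X ≠ 8 := by
    rintro rfl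
    have h1 : ‖((8 : ℚ) : ℚ_[2])‖ ≤ 1 := by exact_mod_cast Padic.norm_int_le_one (p := 2) 8
    have h2 : (1 : ℝ) < 4 ^ (k + 4 + 2) := one_lt_pow₀ (by norm_num) (by omega)
    linarith
  have hU := norm_toU he' (by omega) hX
  have hV := norm_toV_add he' (by omega) hX
  have cU : ((toU X Y : ℚ) : ℚ_[2]) = toU (X : ℚ_[2]) (Y : ℚ_[2]) := by
    unfold toU; push_cast; rfl
  have cV : ((toV X Y : ℚ) : ℚ_[2]) = toV (X : ℚ_[2]) (Y : ℚ_[2]) := by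
    unfold toV; push_cast; rfl
  rw [← cU] at hU
  rw [← cU, ← cV] at hV
  have hq : OnQuartic (toU X Y) (toV X Y) := quartic_toU_toV he h8
  set u := toU X Y with hu
  set v := toV X Y with hv
  have hU' : ‖(u : ℚ_[2])‖ = 2 ^ (k + 5) := by rw [hU]; ring
  have hU32 : 32 ≤ ‖(u : ℚ_[2])‖ := by
    rw [hU']
    calc (32 : ℝ) = 2 ^ 5 := by norm_num
      _ ≤ 2 ^ (k + 5) := pow_le_pow_right₀ one_le_two (by omega)
  obtain ⟨n1, n2, -, -, -⟩ := norm_param hq hU32 hV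
  have hN5 : 0 < ‖(u : ℚ_[2])‖ ^ 5 := by positivity
  have hx₁ : x₁ u v ≠ 0 := by
    intro h
    rw [h, Rat.cast_zero, norm_zero] at n1
    linarith
  have hxx : x₁ u v ^ 2 ≠ x₂ u v ^ 2 := by
    intro h
    have h' : ‖(x₁ u v : ℚ_[2])‖ ^ 2 = ‖(x₂ u v : ℚ_[2])‖ ^ 2 := by
      rw [← norm_pow, ← norm_pow]
      exact_mod_cast congrArg (fun q : ℚ => ‖(q : ℚ_[2])‖) h
    have := (pow_left_inj₀ (norm_nonneg _) (norm_nonneg _) two_ne_zero).mp h'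
    linarith
  obtain ⟨c, x', y', hc, hx', hy'⟩ := exists_integer_multiple (paramX u v) (paramY u v)
  have heq : Equivalent (paramX u v) (paramY u v) (fun i => (x' i : ℚ)) (fun j => (y' j : ℚ)) :=
    ⟨c, hc, 1, 1, hx', hy'⟩
  refine ⟨(x', y'), ⟨(isSolution_param hq).of_smul hx' hy', ?_,
    ⟨2 ^ (k + 4 + 1), X, Y, hXY, hP, h8, c, hc, hx', hy'⟩, fun m n =>
    ⟨not_equivalent_family1 hc hx' hxx, not_equivalent_family2 hc hx' hx₁⟩⟩, ?_⟩
  · refine not_isTrivial_of_ne_zero (by norm_num) fun j hj => ?_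
    have := hy' j
    rw [show y' j = 0 from hj, Int.cast_zero] at this
    exact mul_ne_zero hc (paramY_ne_zero hq hU32 hV j) this.symm
  · have h4 : (2 : ℝ) ^ (k + 7) = 4 * ‖(u : ℚ_[2])‖ := by rw [hU']; ring
    rw [heq.ratioSet_eq, h4]
    exact isGreatest_ratioSet_paramY hq hU32 hV

theorem exists_infinite_solutions :
    ∃ S : Set ((Fin 4 → ℤ) × (Fin 6 → ℤ)), S.Infinite ∧
      (∀ s ∈ S, IsSolution 5 s.1 s.2 ∧ ¬ IsTrivial s.1 s.2 ∧
        ComesFromMultiple (fun i => (s.1 i : ℚ)) (fun j => (s.2 j : ℚ)) ∧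
        ∀ m n : ℚ,
          ¬ Equivalent (family1X m n) (family1Y m n)
            (fun i => (s.1 i : ℚ)) (fun j => (s.2 j : ℚ)) ∧
          ¬ Equivalent (family2X m n) (family2Y m n)
            (fun i => (s.1 i : ℚ)) (fun j => (s.2 j : ℚ))) ∧
      S.Pairwise fun s t =>
        ¬ Equivalent (fun i => (s.1 i : ℚ)) (fun j => (s.2 j : ℚ))
          (fun i => (t.1 i : ℚ)) (fun j => (t.2 j : ℚ)) := by
  choose f hf hr using exists_solution
  -- The greatest ratio `2 ^ (k + 7)` recovers k, so this yields both the infinitude of the range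
  -- and pairwise inequivalence.
  have hinj {k l : ℕ} (h : ratioSet (fun j => ((f k).2 j : ℚ)) =
      ratioSet fun j => ((f l).2 j : ℚ)) : k = l := by
    have := (hr k).unique (h ▸ hr l)
    have := pow_right_injective₀ (by norm_num : (0 : ℝ) < 2) (by norm_num) this
    omega
  refine ⟨Set.range f, Set.infinite_range_of_injective fun k l hkl => hinj (by rw [hkl]), ?_, ?_⟩
  · rintro _ ⟨k, rfl⟩
    exact hf k
  · rintro _ ⟨k, rfl⟩ _ ⟨l, rfl⟩ hne heq
    exact hne (by rw [hinj heq.ratioSet_eq])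

end EqualPowers

theorem mainTheorem8 :
    -- the parametrization solves the system at every rational point of the quartic
    (∀ u v : ℚ, EqualPowers.OnQuartic u v →
      EqualPowers.IsSolution 5 (EqualPowers.paramX u v) (EqualPowers.paramY u v)) ∧
    -- the quartic and the cubic are birational over `ℚ`, through the explicit maps
    (∃ φ : EqualPowers.QuarticFunctionField ≃ₐ[ℚ] EqualPowers.E.toAffine.FunctionField,
      φ EqualPowers.coordU = EqualPowers.toU EqualPowers.coordX EqualPowers.coordY ∧
      φ EqualPowers.coordV = EqualPowers.toV EqualPowers.coordX EqualPowers.coordY ∧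
      EqualPowers.coordX = EqualPowers.toX (φ EqualPowers.coordU) (φ EqualPowers.coordV) ∧
      EqualPowers.coordY = EqualPowers.toY (φ EqualPowers.coordU) (φ EqualPowers.coordV)) ∧
    -- and the maps are mutually inverse on rational points with `X ≠ 8`
    (∀ X Y : ℚ, EqualPowers.E.toAffine.Equation X Y → X ≠ 8 →
      EqualPowers.OnQuartic (EqualPowers.toU X Y) (EqualPowers.toV X Y) ∧
      EqualPowers.toX (EqualPowers.toU X Y) (EqualPowers.toV X Y) = X ∧
      EqualPowers.toY (EqualPowers.toU X Y) (EqualPowers.toV X Y) = Y) ∧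
    (∀ u v : ℚ, EqualPowers.OnQuartic u v →
      EqualPowers.E.toAffine.Equation (EqualPowers.toX u v) (EqualPowers.toY u v) ∧
      (EqualPowers.toX u v ≠ 8 →
        EqualPowers.toU (EqualPowers.toX u v) (EqualPowers.toY u v) = u ∧
        EqualPowers.toV (EqualPowers.toX u v) (EqualPowers.toY u v) = v)) ∧
    -- the cubic is an elliptic curve on which `P = (-3, 4)` has infinite order
    EqualPowers.E.IsElliptic ∧
    ¬ IsOfFinAddOrder EqualPowers.P ∧
    {p : ℚ × ℚ | EqualPowers.OnQuartic p.1 p.2}.Infinite ∧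
    -- the two parametric families solve the system
    (∀ m n : ℚ,
      EqualPowers.IsSolution 5 (EqualPowers.family1X m n) (EqualPowers.family1Y m n) ∧
      EqualPowers.IsSolution 5 (EqualPowers.family2X m n) (EqualPowers.family2Y m n)) ∧
    -- infinitely many further, pairwise inequivalent, nontrivial integer solutions
    (∃ S : Set ((Fin 4 → ℤ) × (Fin 6 → ℤ)), S.Infinite ∧
      (∀ s ∈ S, EqualPowers.IsSolution 5 s.1 s.2 ∧ ¬ EqualPowers.IsTrivial s.1 s.2 ∧
        EqualPowers.ComesFromMultiple (fun i => (s.1 i : ℚ)) (fun j => (s.2 j : ℚ)) ∧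
        ∀ m n : ℚ,
          ¬ EqualPowers.Equivalent (EqualPowers.family1X m n) (EqualPowers.family1Y m n)
            (fun i => (s.1 i : ℚ)) (fun j => (s.2 j : ℚ)) ∧
          ¬ EqualPowers.Equivalent (EqualPowers.family2X m n) (EqualPowers.family2Y m n)
            (fun i => (s.1 i : ℚ)) (fun j => (s.2 j : ℚ))) ∧
      S.Pairwise fun s t =>
        ¬ EqualPowers.Equivalent (fun i => (s.1 i : ℚ)) (fun j => (s.2 j : ℚ))
          (fun i => (t.1 i : ℚ)) (fun j => (t.2 j : ℚ))) := by
  exact ⟨fun _ _ h => EqualPowers.isSolution_param h,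
    EqualPowers.exists_functionField_equiv,
    fun _ _ h hX =>
      have h' := EqualPowers.equation_E_iff.mp h
      ⟨EqualPowers.quartic_toU_toV h' hX, EqualPowers.toX_toU_toV h' hX,
        EqualPowers.toY_toU_toV h' hX⟩,
    fun _ _ h => ⟨EqualPowers.equation_E_iff.mpr (EqualPowers.cubic_toX_toY h),
      fun hX => ⟨EqualPowers.toU_toX_toY hX, EqualPowers.toV_toX_toY h hX⟩⟩,
    EqualPowers.isElliptic_E,
    EqualPowers.not_isOfFinAddOrder_P,
    EqualPowers.infinite_quartic,
    fun m n => ⟨EqualPowers.isSolution_family1 m n, EqualPowers.isSolution_family2 m n⟩,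
    EqualPowers.exists_infinite_solutions⟩
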